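/- Let $K$ be a field, $n\ge 0$, and let $I,J\subseteq\{1,\dots,n\}$. Let $\mathcal I=(x_i : i\in I)$ and $\mathcal J=(x_j : j\in J)$ be the coordinate ideals of $K[x_1,\dots,x_n]$ with clouds $I$ and $J$. Call an ideal of $K[x_1,\dots,x_n]$ *tame* if the blowup of $\mathbb A^n_K$ with this ideal as center is smooth over $K$. Then the product $\mathcal I\cdot\mathcal J$ is tame if and only if $I\cap J=\emptyset$ or $I\subseteq J$ or $J\subseteq I$. Moreover, if none of these three conditions holds, then the Newton polyhedron of $\mathcal I\cdot\mathcal J$ (the convex hull in $\mathbb R^n$ of the exponent vectors of all monomials in $\mathcal I\cdot\mathcal J$) has a vertex whose ideal tangent cone is not simplicial. More precisely, $I\setminus J$ and $J\setminus I$ are nonempty, and for all $i\in I\setminus J$ and $j\in J\setminus I$ the point $\mathbf e_i+\mathbf e_j$ is a vertex of the Newton polyhedron whose ideal tangent cone is pointed and not simplicial. Here the ideal tangent cone of a monomial ideal at $\mathbf a$ is the set of all $\mathbb N$-linear combinations in $\mathbb Z^n$ of the standard basis vectors $\mathbf e_1,\dots,\mathbf e_n$ and of the vectors $\mathbf a'-\mathbf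 a$, where $\mathbf a'\ne\mathbf a$ runs over the exponent vectors of the minimal monomial generators of the ideal. A cone $C$ is pointed if $C\cap(-C)=\{0\}$, and a pointed cone in $\mathbb Z^n$ is simplicial if its minimal set of generators over $\mathbb N$ consists of exactly $n$ vectors. -/

import Mathlib

namespace TameBlowup

open AlgebraicGeometry CategoryTheory

section Blowup

universe u

variable {R : Type u} [CommRing R]

/-- The degree `i` part `I ^ i * T ^ i` of the Rees algebra `⨁ I ^ i * T ^ i`, a subalgebra of the
polynomial ring `R[T]`. -/
noncomputable def reesGrading (I : Ideal R) (i : ℕ) : Submodule R (reesAlgebra I) where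
  carrier := {f | ∀ j, j ≠ i → (f : Polynomial R).coeff j = 0}
  add_mem' {f g} hf hg j hj := by simp [hf j hj, hg j hj]
  zero_mem' j _ := by simp
  smul_mem' r f hf j hj := by simp [hf j hj]

/-- The homogeneous component of degree `i` of an element of the Rees algebra. -/
noncomputable def reesComponent {I : Ideal R} (f : reesAlgebra I) (i : ℕ) : reesGrading I i :=
  ⟨⟨Polynomial.monomial i ((f : Polynomial R).coeff i),
    reesAlgebra.monomial_mem.mpr ((mem_reesAlgebra_iff I _).mp f.2 i)⟩,
    fun j hj => by simp [Polynomial.coeff_monomial, hj.symm]⟩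

instance reesGrading.gradedMonoid (I : Ideal R) : SetLike.GradedMonoid (reesGrading I) where
  one_mem j hj := by simp [Polynomial.coeff_one, hj]
  mul_mem i j f g hf hg k hk := by
    rw [MulMemClass.coe_mul, Polynomial.coeff_mul]
    refine Finset.sum_eq_zero fun p hp => ?_
    have hp' := Finset.HasAntidiagonal.mem_antidiagonal.mp hp
    by_cases h : p.1 = i
    · rw [hg p.2 (fun h' => hk (by rw [← hp', h, h'])), mul_zero]
    · rw [hf p.1 h, zero_mul]

theorem sum_reesComponent {I : Ideal R} (f : reesAlgebra I) :
    DirectSum.coeAddMonoidHom (reesGrading I) (∑ i ∈ (f : Polynomial R).support,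
      DirectSum.of (fun i => reesGrading I i) i (reesComponent f i)) = f := by
  apply Subtype.ext
  rw [map_sum, AddSubmonoidClass.coe_finsetSum]
  simp only [DirectSum.coeAddMonoidHom_of, reesComponent]
  exact (Polynomial.as_sum_support _).symm

theorem coeff_coe_directSum {I : Ideal R} (x : DirectSum ℕ fun i => reesGrading I i) (i : ℕ) :
    ((DirectSum.coeAddMonoidHom (reesGrading I) x : reesAlgebra I) : Polynomial R).coeff i =
      (((x i : reesGrading I i) : reesAlgebra I) : Polynomial R).coeff i := by
  induction x using DirectSum.induction_on with
  | zero => simp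
  | of j y =>
    rw [DirectSum.coeAddMonoidHom_of]
    by_cases h : j = i
    · subst h; rw [DirectSum.of_eq_same]
    · rw [DirectSum.of_eq_of_ne _ _ _ (Ne.symm h), y.2 i (Ne.symm h)]; simp
  | add x y hx hy => simp [hx, hy]

theorem coe_directSum_injective (I : Ideal R) :
    Function.Injective (DirectSum.coeAddMonoidHom (reesGrading I)) := by
  intro x y hxy
  refine DFinsupp.ext fun i => Subtype.ext (Subtype.ext (Polynomial.ext fun j => ?_))
  by_cases h : j = i
  · subst h
    exact (coeff_coe_directSum x j).symm.trans
      ((by rw [hxy] : _ = _).trans (coeff_coe_directSum y j))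
  · rw [(x i).2 j h, (y i).2 j h]

noncomputable instance reesGrading.gradedAlgebra (I : Ideal R) :
    GradedAlgebra (reesGrading I) where
  toGradedMonoid := reesGrading.gradedMonoid I
  decompose' f := ∑ i ∈ (f : Polynomial R).support,
    DirectSum.of (fun i => reesGrading I i) i (reesComponent f i)
  left_inv := sum_reesComponent
  right_inv _ := coe_directSum_injective I (sum_reesComponent _)

/-- The blowup of `Spec R` with center the ideal `I`: the scheme `Proj (⨁ I ^ i * T ^ i)`. -/
noncomputable def blowup (I : Ideal R) : Scheme.{u} :=
  Proj (reesGrading I)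

/-- The blowup map, from the blowup of `Spec R` with center `I` to `Spec R`. -/
noncomputable def blowupMap (I : Ideal R) : blowup I ⟶ Spec (CommRingCat.of R) :=
  Proj.toSpecZero (reesGrading I) ≫
    Spec.map (CommRingCat.ofHom (algebraMap R (reesGrading I 0)))

end Blowup

section Monomial

universe u

variable {K : Type u} [Field K] {n : ℕ}

/-- An ideal of `K[x₁, …, xₙ]` is tame if the blowup of affine `n`-space over `K` with this
ideal as center is smooth over `K`. -/
def IsTame (𝔞 : Ideal (MvPolynomial (Fin n) K)) : Prop :=
  Smooth (blowupMap 𝔞 ≫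
    Spec.map (CommRingCat.ofHom (algebraMap K (MvPolynomial (Fin n) K))))

/-- The coordinate ideal `(xᵢ : i ∈ I)` with cloud `I`. -/
noncomputable def coordinateIdeal (K : Type u) [Field K] (I : Set (Fin n)) : Ideal (MvPolynomial (Fin n) K) :=
  Ideal.span (MvPolynomial.X '' I)

/-- The support of a monomial ideal: all exponent vectors of monomials in the ideal. -/
def exponents (𝔞 : Ideal (MvPolynomial (Fin n) K)) : Set (Fin n →₀ ℕ) :=
  {a | MvPolynomial.monomial a 1 ∈ 𝔞}

/-- The cloud of a monomial ideal: the exponent vectors of its minimal monomial generators. -/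
def cloud (𝔞 : Ideal (MvPolynomial (Fin n) K)) : Set (Fin n →₀ ℕ) :=
  {a | Minimal (fun b => b ∈ exponents 𝔞) a}

/-- The Newton polyhedron of a monomial ideal: the convex hull of its support in `ℝⁿ`. -/
def newtonPolyhedron (𝔞 : Ideal (MvPolynomial (Fin n) K)) : Set (Fin n → ℝ) :=
  convexHull ℝ ((fun (a : Fin n →₀ ℕ) (i : Fin n) => (a i : ℝ)) '' exponents 𝔞)

/-- `a` is a vertex of the Newton polyhedron of `𝔞`. -/
def IsNewtonVertex (𝔞 : Ideal (MvPolynomial (Fin n) K)) (a : Fin n →₀ ℕ) : Prop :=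
  (fun i : Fin n => (a i : ℝ)) ∈ Set.extremePoints ℝ (newtonPolyhedron 𝔞)

/-- The ideal tangent cone of `𝔞` at the monomial with exponent vector `a`: the `ℕ`-span in `ℤⁿ`
of the vectors `a' - a`, for `a' ≠ a` in the cloud of `𝔞`, and of the standard basis vectors. -/
def idealTangentCone (𝔞 : Ideal (MvPolynomial (Fin n) K)) (a : Fin n →₀ ℕ) :
    AddSubmonoid (Fin n → ℤ) :=
  AddSubmonoid.closure {v | ∃ a' ∈ cloud 𝔞, a' ≠ a ∧ v = fun i => (a' i : ℤ) - (a i : ℤ)} ⊔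
    AddSubmonoid.closure (Set.range fun i : Fin n => (Pi.single i 1 : Fin n → ℤ))

/-- A cone is pointed if it contains no nonzero vector together with its negative. -/
def IsPointed (C : AddSubmonoid (Fin n → ℤ)) : Prop :=
  ∀ v, v ∈ C → -v ∈ C → v = 0

/-- `S` is a minimal set of generators of `C`: it generates `C`, and no element of `S` is an
`ℕ`-linear combination of the other elements. -/
def IsMinimalGenerators (C : AddSubmonoid (Fin n → ℤ)) (S : Finset (Fin n → ℤ)) : Prop :=
  AddSubmonoid.closure (S : Set (Fin n → ℤ)) = C ∧
    ∀ v ∈ S, v ∉ AddSubmonoid.closure ((S : Set (Fin n → ℤ)) \ {v})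

/-- A pointed cone in `ℤⁿ` is simplicial if its minimal set of generators, which is unique,
consists of exactly `n` vectors. -/
def IsSimplicial (C : AddSubmonoid (Fin n → ℤ)) : Prop :=
  IsPointed C ∧ ∃ S : Finset (Fin n → ℤ), IsMinimalGenerators C S ∧ S.card = n

end Monomial

end TameBlowup

open TameBlowup

namespace TameBlowup

open AlgebraicGeometry CategoryTheory

universe u

/-! The blowup is covered by charts at the generators `x_a x_b`. The coordinate ring of such a chart
sits inside the Laurent polynomial ring as the monoid algebra of the ideal tangent cone at `e_a +
e_b`, so smoothness becomes a question about these cones.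

If `I ∩ J = ∅` or `I ⊆ J`, the charts with `b ∉ I` or `a = b` already cover, because `(x_a x_b)^2 =
x_a^2 * x_b^2`. Their cones are free on `n` vectors, so these charts are affine spaces
(`smooth_chartMap_X_mul_X`).

Otherwise take `k ∈ I ∩ J`, `i ∈ I \ J`, `j ∈ J \ I`. The identity `e_i + (e_k - e_i) = e_j + (e_k -
e_j)` is a relation `x u = y v` in the chart at `x_i x_j`. One weight controls everything: it is at
least `1` on every nonzero vector of the cone (`eq_zero_or_one_le_weight`) and exactly `1` on these
four. Hence the cone is pointed. Prescribing the values `1, 1, 0, 0` at `x, u, y, v` gives a tangent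
vector that does not lift to second order, so the chart is singular
(`mul_ne_mul_of_formallySmooth`). Vectors of weight one belong to every generating set, and there
are at least `n + 1` of them, so the cone is not simplicial. The same weight, as a linear
functional, is minimal on the Newton polyhedron only at `e_i + e_j`. -/

theorem smooth_of_smooth_awayι {A τ : Type u} [CommRing A] [SetLike τ A] [AddSubgroupClass τ A]
    (𝒜 : ℕ → τ) [GradedRing 𝒜] {ι : Type*} (f : ι → A) {m : ℕ} (hf : ∀ i, f i ∈ 𝒜 m) (hm : 0 < m)
    (hcov : ⨆ i, Proj.basicOpen 𝒜 (f i) = ⊤) {Y : Scheme.{u}} (g : Proj 𝒜 ⟶ Y)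
    (h : ∀ i, Smooth (Proj.awayι 𝒜 (f i) (hf i) hm ≫ g)) : Smooth g := by
  have : IsZariskiLocalAtSource @Smooth.{u} :=
    HasRingHomProperty.instIsZariskiLocalAtSource (Q := RingHom.Smooth)
  refine IsZariskiLocalAtSource.of_iSup_eq_top (fun i => Proj.basicOpen 𝒜 (f i)) hcov fun i => ?_
  have h1 := h i
  rw [← Proj.basicOpenIsoSpec_inv_ι, Category.assoc] at h1
  have h2 : Smooth ((Proj.basicOpenIsoSpec 𝒜 (f i) (hf i) hm).hom ≫
      (Proj.basicOpenIsoSpec 𝒜 (f i) (hf i) hm).inv ≫ (Proj.basicOpen 𝒜 (f i)).ι ≫ g) :=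
    inferInstance
  rwa [Iso.hom_inv_id_assoc] at h2

/-! ### Affine charts of the blowup -/

section Charts

variable {R : Type u} [CommRing R] {I : Ideal R}

/-- The element `r T ^ k` of the Rees algebra, for `r ∈ I ^ k`. -/
noncomputable def reesMonomial (k : ℕ) (r : R) (hr : r ∈ I ^ k) : reesAlgebra I :=
  ⟨Polynomial.monomial k r, reesAlgebra.monomial_mem.mpr hr⟩

theorem reesMonomial_mem (k : ℕ) (r : R) (hr : r ∈ I ^ k) :
    reesMonomial k r hr ∈ reesGrading I k := fun j hj => by
  simp [reesMonomial, Polynomial.coeff_monomial, hj.symm]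

theorem eq_reesMonomial_of_mem {k : ℕ} {f : reesAlgebra I} (hf : f ∈ reesGrading I k) :
    f = reesMonomial k ((f : Polynomial R).coeff k) ((mem_reesAlgebra_iff I _).mp f.2 k) := by
  refine Subtype.ext (Polynomial.ext fun j => ?_)
  by_cases h : j = k
  · subst h; simp [reesMonomial]
  · rw [hf j h]; simp [reesMonomial, Polynomial.coeff_monomial, Ne.symm h]

/-- The element `r T` of the Rees algebra, for `r ∈ I`. -/
noncomputable def reesGen (r : R) (hr : r ∈ I) : reesAlgebra I :=
  reesMonomial 1 r (by rwa [pow_one])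

theorem reesGen_mem (r : R) (hr : r ∈ I) : reesGen r hr ∈ reesGrading I 1 :=
  reesMonomial_mem _ _ _

/-- An element of `I ^ k * I` is a sum of products `p * q`, so its Rees monomial is a sum of
products `(p T ^ k) (q T)`, with `q` an `R`-combination of `S`. This bounds the irrelevant ideal by
the degree-one generators. -/
theorem reesMonomial_mem_of_reesGen_mem {S : Set R} (hS : I = Ideal.span S)
    (Q : Ideal (reesAlgebra I))
    (hQ : ∀ s (hs : s ∈ S), reesGen s (hS ▸ Ideal.subset_span hs) ∈ Q) (k : ℕ) (r : R)
    (hr : r ∈ I ^ (k + 1)) : reesMonomial (k + 1) r hr ∈ Q := by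
  have h1 : ∀ r (hr : r ∈ I), reesGen r hr ∈ Q := by
    intro r hr
    have hr' : r ∈ Submodule.span R S := by rw [← Ideal.span, ← hS]; exact hr
    induction hr' using Submodule.span_induction with
    | mem s hs => exact hQ s hs
    | zero =>
      convert Q.zero_mem
      exact Subtype.ext (by simp [reesGen, reesMonomial])
    | add x y hx hy ihx ihy =>
      have hx' : x ∈ I := by rw [hS]; exact hx
      have hy' : y ∈ I := by rw [hS]; exact hy
      convert Q.add_mem (ihx hx') (ihy hy')
      exact Subtype.ext (by simp [reesGen, reesMonomial])
    | smul a x hx ihx =>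
      have hx' : x ∈ I := by rw [hS]; exact hx
      convert Q.mul_mem_left (algebraMap R _ a) (ihx hx')
      refine Subtype.ext ?_
      simp [reesGen, reesMonomial, Polynomial.C_mul_monomial]
  have h2 : r ∈ I ^ k * I := by rwa [← pow_succ]
  induction h2 using Submodule.mul_induction_on' with
  | mem_mul_mem p hp q hq =>
    convert Q.mul_mem_left (reesMonomial k p hp) (h1 q hq)
    refine Subtype.ext ?_
    simp [reesGen, reesMonomial, Polynomial.monomial_mul_monomial]
  | add x hx y hy ihx ihy =>
    rw [← pow_succ] at hx hy
    convert Q.add_mem (ihx hx) (ihy hy)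
    exact Subtype.ext (by simp [reesMonomial])

theorem iSup_basicOpen_reesGen_eq_top {S : Set R} (hS : I = Ideal.span S) :
    ⨆ s : S, Proj.basicOpen (reesGrading I) (reesGen s.1 (hS ▸ Ideal.subset_span s.2)) = ⊤ := by
  apply Proj.iSup_basicOpen_eq_top
  classical
  intro f hf
  rw [← DirectSum.sum_support_decompose (reesGrading I) f]
  refine Ideal.sum_mem _ fun i _ => ?_
  rcases i with _ | k
  · convert Ideal.zero_mem _
    exact hf
  · rw [eq_reesMonomial_of_mem (DirectSum.decompose (reesGrading I) f (k + 1)).2]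
    exact reesMonomial_mem_of_reesGen_mem hS _
      (fun s hs => Ideal.subset_span (Set.mem_range_self (⟨s, hs⟩ : S))) _ _ _

/-- The coordinate ring of the chart `D₊(r T)` of the blowup of `Spec R` in `I`. -/
abbrev Chart (r : R) (hr : r ∈ I) : Type u :=
  HomogeneousLocalization.Away (reesGrading I) (reesGen r hr)

/-- The structure map from `R` to the coordinate ring of a chart of the blowup. -/
noncomputable def chartMap (r : R) (hr : r ∈ I) : R →+* Chart r hr :=
  (HomogeneousLocalization.fromZeroRingHom (reesGrading I) _).comp
    (algebraMap R (reesGrading I 0))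

/-- The open immersion of a chart into the blowup. -/
noncomputable def chartι (r : R) (hr : r ∈ I) :
    Spec (CommRingCat.of (Chart r hr)) ⟶ blowup I :=
  Proj.awayι (reesGrading I) (reesGen r hr) (reesGen_mem r hr) one_pos

instance (r : R) (hr : r ∈ I) : IsOpenImmersion (chartι r hr) :=
  inferInstanceAs (IsOpenImmersion (Proj.awayι (reesGrading I) (reesGen r hr) (reesGen_mem r hr)
    one_pos))

theorem chartι_blowupMap (r : R) (hr : r ∈ I) :
    chartι r hr ≫ blowupMap I = Spec.map (CommRingCat.ofHom (chartMap r hr)) := by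
  have h := Proj.awayι_toSpecZero_assoc (reesGrading I) (reesGen r hr) (reesGen_mem r hr) one_pos
    (Spec.map (CommRingCat.ofHom (algebraMap R (reesGrading I 0))))
  rw [← Spec.map_comp] at h
  exact h

variable {k : Type u} [CommRing k] (σ : k →+* R)

theorem chartι_comp (r : R) (hr : r ∈ I) :
    chartι r hr ≫ blowupMap I ≫ Spec.map (CommRingCat.ofHom σ) =
      Spec.map (CommRingCat.ofHom ((chartMap r hr).comp σ)) := by
  rw [← Category.assoc, chartι_blowupMap, ← Spec.map_comp]
  rfl

theorem smooth_chartMap_comp_iff (r : R) (hr : r ∈ I) :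
    Smooth (Proj.awayι (reesGrading I) (reesGen r hr) (reesGen_mem r hr) one_pos ≫
      blowupMap I ≫ Spec.map (CommRingCat.ofHom σ)) ↔ ((chartMap r hr).comp σ).Smooth := by
  have h := chartι_comp σ r hr
  rw [← CommRingCat.hom_ofHom ((chartMap r hr).comp σ),
    ← HasRingHomProperty.Spec_iff (P := @Smooth), ← h]
  rfl

theorem smooth_chartMap_of_smooth (h : Smooth (blowupMap I ≫ Spec.map (CommRingCat.ofHom σ)))
    (r : R) (hr : r ∈ I) : ((chartMap r hr).comp σ).Smooth :=
  (smooth_chartMap_comp_iff σ r hr).mp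
    (smooth_comp (chartι r hr) (blowupMap I ≫ Spec.map (CommRingCat.ofHom σ)))

theorem smooth_of_smooth_chartMap {ι : Type*} (r : ι → R) (hr : ∀ i, r i ∈ I)
    (hcov : ⨆ i, Proj.basicOpen (reesGrading I) (reesGen (r i) (hr i)) = ⊤)
    (h : ∀ i, ((chartMap (r i) (hr i)).comp σ).Smooth) :
    Smooth (blowupMap I ≫ Spec.map (CommRingCat.ofHom σ)) :=
  smooth_of_smooth_awayι (reesGrading I) (fun i => reesGen (r i) (hr i))
    (fun i => reesGen_mem _ (hr i)) one_pos hcov (blowupMap I ≫ Spec.map (CommRingCat.ofHom σ))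
    fun i => (smooth_chartMap_comp_iff σ (r i) (hr i)).mpr (h i)

end Charts

/-! ### Laurent polynomials -/

section Laurent

variable {K : Type u} [Field K] {n : ℕ}

/-- The Laurent polynomial ring in `n` variables. -/
abbrev Laurent (K : Type u) [Field K] (n : ℕ) : Type u := AddMonoidAlgebra K (Fin n → ℤ)

/-- The Laurent monomial with exponent vector `c`. -/
noncomputable def laurentMonomial (K : Type u) [Field K] (c : Fin n → ℤ) : Laurent K n :=
  AddMonoidAlgebra.single c 1

theorem laurentMonomial_zero : laurentMonomial K (0 : Fin n → ℤ) = 1 := rfl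

theorem laurentMonomial_add (a b : Fin n → ℤ) :
    laurentMonomial K (a + b) = laurentMonomial K a * laurentMonomial K b := by
  simp [laurentMonomial, AddMonoidAlgebra.single_mul_single]

theorem isUnit_laurentMonomial (a : Fin n → ℤ) : IsUnit (laurentMonomial K a) :=
  IsUnit.of_mul_eq_one (laurentMonomial K (-a)) (by
    rw [← laurentMonomial_add, add_neg_cancel, laurentMonomial_zero])

/-- The embedding of the polynomial ring into the Laurent polynomial ring. -/
noncomputable def toLaurent (K : Type u) [Field K] (n : ℕ) :
    MvPolynomial (Fin n) K →ₐ[K] Laurent K n :=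
  MvPolynomial.aeval fun l => laurentMonomial K (Pi.single l 1)

@[simp]
theorem toLaurent_X (l : Fin n) :
    toLaurent K n (MvPolynomial.X l) = laurentMonomial K (Pi.single l 1) := by
  simp [toLaurent]

/-- Both rings are monoid algebras, and the map is induced by the injection `ℕⁿ → ℤⁿ`. -/
theorem toLaurent_injective : Function.Injective (toLaurent K n) := by
  let e : (Fin n →₀ ℕ) →+ (Fin n → ℤ) :=
    { toFun := fun a l => (a l : ℤ)
      map_zero' := by ext; simp
      map_add' := fun a b => by ext; simp }
  have he : Function.Injective e := fun a b h => by
    ext l; exact Nat.cast_injective (R := ℤ) (congrFun h l)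
  have h : toLaurent K n = AddMonoidAlgebra.mapDomainAlgHom K K e := by
    refine MvPolynomial.algHom_ext fun l => ?_
    rw [toLaurent_X]
    have h1 : (MvPolynomial.X l : MvPolynomial (Fin n) K) =
      AddMonoidAlgebra.single (Finsupp.single l 1) 1 := rfl
    rw [h1, AddMonoidAlgebra.mapDomainAlgHom_apply, AddMonoidAlgebra.mapDomain_single]
    congr 1
    ext m
    simp [e, Pi.single_apply, Finsupp.single_apply, eq_comm]
  rw [h]
  exact AddMonoidAlgebra.mapDomain_injective he

end Laurent

/-! ### Charts as subrings of the Laurent polynomial ring -/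

section ChartToLaurent

variable {K : Type u} [Field K] {n : ℕ} {𝔞 : Ideal (MvPolynomial (Fin n) K)}

/-- The map from the Rees algebra to the Laurent polynomial ring that sends `T` to the Laurent
monomial with exponent vector `-w`. -/
noncomputable def reesToLaurent (𝔞 : Ideal (MvPolynomial (Fin n) K)) (w : Fin n → ℤ) :
    reesAlgebra 𝔞 →+* Laurent K n :=
  (Polynomial.eval₂RingHom (toLaurent K n).toRingHom (laurentMonomial K (-w))).comp
    (reesAlgebra 𝔞).val.toRingHom

theorem reesToLaurent_reesMonomial (w : Fin n → ℤ) (k : ℕ) (p : MvPolynomial (Fin n) K)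
    (hp : p ∈ 𝔞 ^ k) : reesToLaurent 𝔞 w (reesMonomial k p hp) =
      toLaurent K n p * laurentMonomial K (-w) ^ k := by
  simp [reesToLaurent, reesMonomial]

variable {w : Fin n → ℤ} {r : MvPolynomial (Fin n) K} (hr : r ∈ 𝔞)
  (hw : toLaurent K n r = laurentMonomial K w)

include hw in
theorem reesToLaurent_reesGen_self : reesToLaurent 𝔞 w (reesGen r hr) = 1 := by
  rw [reesGen, reesToLaurent_reesMonomial, hw, pow_one, ← laurentMonomial_add, add_neg_cancel,
    laurentMonomial_zero]

/-- The embedding of the coordinate ring of a chart of the blowup into the Laurent polynomial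
ring. -/
noncomputable def chartToLaurent : Chart r hr →+* Laurent K n :=
  (IsLocalization.Away.lift (S := Localization.Away (reesGen r hr)) (reesGen r hr)
    (g := reesToLaurent 𝔞 w) (by rw [reesToLaurent_reesGen_self hr hw]; exact isUnit_one)).comp
  (algebraMap (Chart r hr) (Localization.Away (reesGen r hr)))

theorem exists_eq_mk (x : Chart r hr) : ∃ k p, ∃ hp : p ∈ 𝔞 ^ k,
    x = HomogeneousLocalization.Away.mk (reesGrading 𝔞) (reesGen_mem r hr) k
      (reesMonomial k p hp) (by simpa using reesMonomial_mem k p hp) := by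
  obtain ⟨k, a, ha, rfl⟩ := HomogeneousLocalization.Away.mk_surjective (reesGrading 𝔞)
    (reesGen_mem r hr) x
  have ha' : a ∈ reesGrading 𝔞 k := by simpa using ha
  refine ⟨k, _, (mem_reesAlgebra_iff 𝔞 _).mp a.2 k, ?_⟩
  congr 1
  exact eq_reesMonomial_of_mem ha'

theorem chartToLaurent_mk (k : ℕ) (p : MvPolynomial (Fin n) K) (hp : p ∈ 𝔞 ^ k) (h) :
    chartToLaurent hr hw (HomogeneousLocalization.Away.mk (reesGrading 𝔞) (reesGen_mem r hr) k
      (reesMonomial k p hp) h) = toLaurent K n p * laurentMonomial K (-w) ^ k := by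
  rw [chartToLaurent, RingHom.comp_apply, HomogeneousLocalization.algebraMap_apply,
    HomogeneousLocalization.Away.val_mk, Localization.mk_eq_mk', IsLocalization.Away.lift,
    IsLocalization.lift_mk'_spec, map_pow, reesToLaurent_reesGen_self hr hw, one_pow, one_mul,
    reesToLaurent_reesMonomial]

theorem chartToLaurent_injective : Function.Injective (chartToLaurent hr hw) := by
  rw [injective_iff_map_eq_zero]
  intro x hx
  obtain ⟨k, p, hp, rfl⟩ := exists_eq_mk hr x
  rw [chartToLaurent_mk, ((isUnit_laurentMonomial (-w)).pow k).mul_left_eq_zero,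
    map_eq_zero_iff _ toLaurent_injective] at hx
  subst hx
  refine HomogeneousLocalization.val_injective _ ?_
  rw [HomogeneousLocalization.Away.val_mk, HomogeneousLocalization.val_zero]
  have h0 : reesMonomial k 0 hp = 0 := Subtype.ext (by simp [reesMonomial])
  rw [h0, Localization.mk_zero]

theorem chartToLaurent_chartMap (p : MvPolynomial (Fin n) K) :
    chartToLaurent hr hw (chartMap r hr p) = toLaurent K n p := by
  have h : chartMap r hr p = HomogeneousLocalization.Away.mk (reesGrading 𝔞) (reesGen_mem r hr) 0
      (reesMonomial 0 p (by simp)) (by simpa using reesMonomial_mem 0 p (by simp)) := by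
    refine HomogeneousLocalization.val_injective _ ?_
    rw [HomogeneousLocalization.Away.val_mk]
    change Localization.mk _ _ = _
    congr 1
  rw [h, chartToLaurent_mk, pow_zero, mul_one]

theorem toLaurent_mul_mem_range {s : MvPolynomial (Fin n) K} (hs : s ∈ 𝔞) :
    toLaurent K n s * laurentMonomial K (-w) ∈ Set.range (chartToLaurent hr hw) :=
  ⟨HomogeneousLocalization.Away.mk (reesGrading 𝔞) (reesGen_mem r hr) 1
      (reesMonomial 1 s (by rwa [pow_one])) (by simpa using reesMonomial_mem 1 s _), by
    rw [chartToLaurent_mk, pow_one]⟩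

/-- A chart is generated over `K` by the variables and the quotients `g / r` with `g ∈ G`: a
fraction of degree `k` has its numerator in `𝔞 ^ k`, which splits into products of `k` elements of
`𝔞`. -/
theorem range_chartToLaurent_le (S : Subalgebra K (Laurent K n))
    (hX : ∀ l, laurentMonomial K (Pi.single l 1) ∈ S) {G : Set (MvPolynomial (Fin n) K)}
    (hG : 𝔞 = Ideal.span G) (hGS : ∀ g ∈ G, toLaurent K n g * laurentMonomial K (-w) ∈ S) :
    Set.range (chartToLaurent hr hw) ⊆ S := by
  have hι : ∀ p, toLaurent K n p ∈ S := fun p => by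
    induction p using MvPolynomial.induction_on with
    | C a =>
      rw [← MvPolynomial.algebraMap_eq, AlgHom.commutes]
      exact S.algebraMap_mem a
    | add p q hp hq => rw [map_add]; exact S.add_mem hp hq
    | mul_X p l hp => rw [map_mul, toLaurent_X]; exact S.mul_mem hp (hX l)
  have h1 : ∀ p ∈ 𝔞, toLaurent K n p * laurentMonomial K (-w) ∈ S := fun p hp => by
    rw [hG] at hp
    induction hp using Submodule.span_induction with
    | mem g hg => exact hGS g hg
    | zero => simp
    | add p q _ _ hp hq => rw [map_add, add_mul]; exact S.add_mem hp hq
    | smul a p _ hp =>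
      rw [smul_eq_mul, map_mul, mul_assoc]; exact S.mul_mem (hι a) hp
  have h2 : ∀ k, ∀ p ∈ 𝔞 ^ k, toLaurent K n p * laurentMonomial K (-w) ^ k ∈ S := by
    intro k
    induction k with
    | zero => intro p _; simpa using hι p
    | succ k ih =>
      intro p hp
      rw [pow_succ] at hp
      induction hp using Submodule.mul_induction_on' with
      | mem_mul_mem p hp q hq =>
        have := S.mul_mem (ih p hp) (h1 q hq)
        rw [map_mul, pow_succ]
        convert this using 1
        ring
      | add p _ q _ hp hq => rw [map_add, add_mul]; exact S.add_mem hp hq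
  rintro _ ⟨x, rfl⟩
  obtain ⟨k, p, hp, rfl⟩ := exists_eq_mk hr x
  rw [chartToLaurent_mk]
  exact h2 k p hp

end ChartToLaurent

/-! ### Charts with a free monoid of exponents -/

section SmoothCharts

variable {K : Type u} [Field K] {n : ℕ} {𝔞 : Ideal (MvPolynomial (Fin n) K)}

theorem laurentMonomial_mem_range_aeval {g : Fin n → Fin n → ℤ} {c : Fin n → ℤ}
    (hc : c ∈ AddSubmonoid.closure (Set.range g)) :
    laurentMonomial K c ∈ (MvPolynomial.aeval (R := K) fun l => laurentMonomial K (g l)).range := by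
  induction hc using AddSubmonoid.closure_induction with
  | mem c hc =>
    obtain ⟨l, rfl⟩ := hc
    exact ⟨MvPolynomial.X l, by simp⟩
  | zero => exact one_mem _
  | add a b _ _ ha hb => rw [laurentMonomial_add]; exact mul_mem ha hb

/-- A chart of the blowup whose exponents form a free monoid is smooth. -/
theorem smooth_chartMap_of_free {w : Fin n → ℤ} {r : MvPolynomial (Fin n) K} (hr : r ∈ 𝔞)
    (hw : toLaurent K n r = laurentMonomial K w) (g : Fin n → Fin n → ℤ)
    (h : (Fin n → ℤ) →+ (Fin n → ℤ)) (hgh : ∀ l, h (g l) = Pi.single l 1)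
    (hg : ∀ l, laurentMonomial K (g l) ∈ Set.range (chartToLaurent hr hw))
    (hX : ∀ l, Pi.single l 1 ∈ AddSubmonoid.closure (Set.range g))
    {G : Set (MvPolynomial (Fin n) K)} (hG : 𝔞 = Ideal.span G)
    (hGg : ∀ s ∈ G, ∃ c ∈ AddSubmonoid.closure (Set.range g),
      toLaurent K n s * laurentMonomial K (-w) = laurentMonomial K c) :
    ((chartMap r hr).comp (algebraMap K (MvPolynomial (Fin n) K))).Smooth := by
  let : Algebra K (Chart r hr) :=
    ((chartMap r hr).comp (algebraMap K (MvPolynomial (Fin n) K))).toAlgebra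
  let φ : Chart r hr →ₐ[K] Laurent K n :=
    { chartToLaurent hr hw with
      commutes' := fun a => by
        change chartToLaurent hr hw (chartMap r hr _) = _
        rw [chartToLaurent_chartMap, AlgHom.commutes] }
  let ψ : MvPolynomial (Fin n) K →ₐ[K] Laurent K n :=
    MvPolynomial.aeval fun l => laurentMonomial K (g l)
  have hφ : Function.Injective φ := chartToLaurent_injective hr hw
  -- Since `h` carries the vectors `g l` back to the standard basis, applying it to exponents turns
  -- `ψ` into the injective map `toLaurent`.
  have hψ : Function.Injective ψ := by
    have : (AddMonoidAlgebra.mapDomainAlgHom K K h).comp ψ = toLaurent K n :=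
      MvPolynomial.algHom_ext fun l => by
        simp [ψ, laurentMonomial, ← hgh]
    refine Function.Injective.of_comp (f := AddMonoidAlgebra.mapDomainAlgHom K K h) ?_
    rw [← AlgHom.coe_comp, this]
    exact toLaurent_injective
  have hrange : ψ.range = φ.range := by
    refine le_antisymm ?_ fun x hx => range_chartToLaurent_le hr hw ψ.range
      (fun l => laurentMonomial_mem_range_aeval (hX l)) hG (fun s hs => ?_) hx
    · rw [← Algebra.map_top, ← MvPolynomial.adjoin_range_X, AlgHom.map_adjoin, Algebra.adjoin_le_iff]
      rintro _ ⟨_, ⟨l, rfl⟩, rfl⟩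
      obtain ⟨y, hy⟩ := hg l
      exact ⟨y, hy.trans (by simp [ψ])⟩
    · obtain ⟨c, hc, hsc⟩ := hGg s hs
      rw [hsc]
      exact laurentMonomial_mem_range_aeval hc
  have e : MvPolynomial (Fin n) K ≃ₐ[K] Chart r hr :=
    ((AlgEquiv.ofInjective ψ hψ).trans (Subalgebra.equivOfEq _ _ hrange)).trans
      (AlgEquiv.ofInjective φ hφ).symm
  have : Algebra.Smooth K (MvPolynomial (Fin n) K) := ⟨inferInstance, inferInstance⟩
  exact Algebra.Smooth.of_equiv e

end SmoothCharts

/-! ### The tame cases -/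

section Coordinate

variable {K : Type u} [Field K] {n : ℕ} {I J : Set (Fin n)}

theorem coordinateIdeal_mul_eq_span (I J : Set (Fin n)) :
    coordinateIdeal K I * coordinateIdeal K J =
      Ideal.span (Set.image2 (fun a b => MvPolynomial.X a * MvPolynomial.X b) I J) := by
  rw [coordinateIdeal, coordinateIdeal, Ideal.span_mul_span']
  congr 1
  ext s
  simp [Set.mem_mul, Set.mem_image2]

theorem X_mul_X_mem {a b : Fin n} (ha : a ∈ I) (hb : b ∈ J) :
    MvPolynomial.X a * MvPolynomial.X b ∈ coordinateIdeal K I * coordinateIdeal K J :=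
  Ideal.mul_mem_mul (Ideal.subset_span ⟨a, ha, rfl⟩) (Ideal.subset_span ⟨b, hb, rfl⟩)

theorem toLaurent_X_mul_X (a b : Fin n) :
    toLaurent K n (MvPolynomial.X a * MvPolynomial.X b) =
      laurentMonomial K (Pi.single a 1 + Pi.single b 1) := by
  rw [map_mul, toLaurent_X, toLaurent_X, laurentMonomial_add]

theorem laurentMonomial_single_mem_range {i j : Fin n} (hi : i ∈ I) (hj : j ∈ J) (l : Fin n) :
    laurentMonomial K (Pi.single l 1) ∈ Set.range
      (chartToLaurent (X_mul_X_mem (K := K) hi hj) (toLaurent_X_mul_X i j)) :=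
  ⟨chartMap _ _ (MvPolynomial.X l), by rw [chartToLaurent_chartMap, toLaurent_X]⟩

theorem laurentMonomial_sub_mem_range {i j a b : Fin n} (hi : i ∈ I) (hj : j ∈ J) (ha : a ∈ I)
    (hb : b ∈ J) {c : Fin n → ℤ}
    (hc : c = Pi.single a 1 + Pi.single b 1 - (Pi.single i 1 + Pi.single j 1)) :
    laurentMonomial K c ∈ Set.range
      (chartToLaurent (X_mul_X_mem (K := K) hi hj) (toLaurent_X_mul_X i j)) := by
  have := toLaurent_mul_mem_range (X_mul_X_mem (K := K) hi hj) (toLaurent_X_mul_X i j)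
    (X_mul_X_mem ha hb)
  rwa [toLaurent_X_mul_X, ← laurentMonomial_add, ← sub_eq_add_neg, ← hc] at this

/-- The chart of the blowup at `xᵢ xⱼ` is an affine space if `xᵢ xⱼ` is a vertex at which the
cone is free. -/
theorem smooth_chartMap_X_mul_X {i j : Fin n} (hi : i ∈ I) (hj : j ∈ J) (hij : j ∈ I → i = j)
    (hIJ : ∀ b ∈ I, b ∈ J → i ∈ J) :
    ((chartMap _ (X_mul_X_mem (K := K) hi hj)).comp
      (algebraMap K (MvPolynomial (Fin n) K))).Smooth := by
  classical
  let E : Fin n → Fin n → ℤ := fun l => Pi.single l 1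
  -- The candidate basis of the cone. An index in `I ∩ J` other than `i` is compared with `i`, not
  -- `j`. If `i ∈ J` and `i ≠ j`, the `i`-th vector is `E i - E j`.
  let g : Fin n → Fin n → ℤ := fun l =>
    if l ∈ I ∧ l ≠ i then E l - E i else if l ∈ J ∧ l ≠ j then E l - E j else E l
  -- The change of coordinates inverse to `g` is found in two stages, because `E l - E i` involves
  -- `E i`, which may itself have to be rewritten through `E j`.
  let h₀ : Fin n → Fin n → ℤ := fun l =>
    if l ∈ J ∧ l ≠ j then E l + E j else E l
  let h₁ : Fin n → Fin n → ℤ := fun l =>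
    if l ∈ I ∧ l ≠ i then E l + h₀ i else h₀ l
  let h : (Fin n → ℤ) →+ (Fin n → ℤ) :=
    ∑ l, (zmultiplesHom (Fin n → ℤ) (h₁ l)).comp (Pi.evalAddMonoidHom (fun _ => ℤ) l)
  have hE : ∀ l, h (E l) = h₁ l := fun l => by
    simp only [h, E, AddMonoidHom.finsetSum_apply, AddMonoidHom.comp_apply,
      Pi.evalAddMonoidHom_apply, zmultiplesHom_apply]
    rw [Finset.sum_eq_single l]
    · simp
    · intro b _ hb; simp [hb]
    · simp
  let M := AddSubmonoid.closure (Set.range g)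
  have hgM : ∀ l, g l ∈ M := fun l => AddSubmonoid.subset_closure ⟨l, rfl⟩
  have hjM : E j ∈ M := by
    have : g j = E j := by
      simp only [g]; rw [if_neg (by rintro ⟨h1, h2⟩; exact h2 (hij h1).symm), if_neg (by simp)]
    rw [← this]; exact hgM j
  have hiM : E i ∈ M := by
    by_cases h : i ∈ J ∧ i ≠ j
    · have : E i = g i + E j := by simp [g, h]
      rw [this]; exact M.add_mem (hgM i) hjM
    · have : E i = g i := by simp [g, h]
      rw [this]; exact hgM i
  have hI : ∀ a ∈ I, E a - E i ∈ M := fun a ha => by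
    by_cases h : a = i
    · subst h; rw [sub_self]; exact M.zero_mem
    · have : E a - E i = g a := by simp [g, h, ha]
      rw [this]; exact hgM a
  have hJ' : ∀ b ∈ J, (b ∈ I → b = i) → E b - E j ∈ M := fun b hb hbI => by
    by_cases h : b = j
    · subst h; rw [sub_self]; exact M.zero_mem
    · have : E b - E j = g b := by
        simp only [g]
        rw [if_neg (by rintro ⟨h1, h2⟩; exact h2 (hbI h1)), if_pos ⟨hb, h⟩]
      rw [this]; exact hgM b
  -- For `b ∈ I ∩ J` the difference passes through `i`; this is where `hIJ` is needed, to know that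
  -- `E i - E j` is available.
  have hJ : ∀ b ∈ J, E b - E j ∈ M := fun b hb => by
    by_cases hbI : b ∈ I
    · rw [← sub_add_sub_cancel (E b) (E i) (E j)]
      exact M.add_mem (hI b hbI) (hJ' i (hIJ b hbI hb) fun _ => rfl)
    · exact hJ' b hb fun h => absurd h hbI
  refine smooth_chartMap_of_free (X_mul_X_mem hi hj) (toLaurent_X_mul_X i j) g h ?_ ?_ ?_
    (coordinateIdeal_mul_eq_span I J) ?_
  · intro l
    have h₁i : h₁ i = h₀ i := by simp [h₁]
    have h₁j : h₁ j = E j := by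
      simp only [h₁, h₀]
      rw [if_neg (by rintro ⟨h1, h2⟩; exact h2 (hij h1).symm), if_neg (by simp)]
    change h (g l) = E l
    by_cases hl : l ∈ I ∧ l ≠ i
    · simp only [g, if_pos hl, map_sub, hE, h₁i]
      simp only [h₁, if_pos hl, add_sub_cancel_right]
    · by_cases hl' : l ∈ J ∧ l ≠ j
      · simp only [g, if_neg hl, if_pos hl', map_sub, hE, h₁j]
        simp only [h₁, h₀, if_neg hl, if_pos hl', add_sub_cancel_right]
      · simp only [g, if_neg hl, if_neg hl', hE]
        simp only [h₁, h₀, if_neg hl, if_neg hl']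
  · intro l
    simp only [g]
    split_ifs with hl hl'
    · exact laurentMonomial_sub_mem_range hi hj hl.1 hj (by simp [E])
    · exact laurentMonomial_sub_mem_range hi hj hi hl'.1 (by simp [E])
    · exact laurentMonomial_single_mem_range hi hj l
  · intro l
    by_cases hl : l ∈ I
    · have := M.add_mem (hI l hl) hiM
      rwa [sub_add_cancel] at this
    · by_cases hl' : l ∈ J
      · have := M.add_mem (hJ l hl') hjM
        rwa [sub_add_cancel] at this
      · have : g l = E l := by simp [g, hl, hl']
        have h2 := hgM l
        rwa [this] at h2
  · rintro _ ⟨a, ha, b, hb, rfl⟩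
    refine ⟨_, M.add_mem (hI a ha) (hJ b hb), ?_⟩
    rw [toLaurent_X_mul_X, ← laurentMonomial_add]
    congr 1
    simp only [E]
    abel

/-- Charts with `a ≠ b` and `b ∈ I` are left out. When `I ⊆ J`, such a point `e_a + e_b` is the
midpoint of `2 e_a` and `2 e_b`, so it is no vertex and its cone is not pointed. -/
theorem isTame_of_disjoint_or_subset (h : I ∩ J = ∅ ∨ I ⊆ J) :
    IsTame (coordinateIdeal K I * coordinateIdeal K J) := by
  refine smooth_of_smooth_chartMap (algebraMap K (MvPolynomial (Fin n) K))
    (ι := {p : Fin n × Fin n // p.1 ∈ I ∧ p.2 ∈ J ∧ (p.2 ∈ I → p.1 = p.2)})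
    (fun p => MvPolynomial.X p.1.1 * MvPolynomial.X p.1.2)
    (fun p => X_mul_X_mem p.2.1 p.2.2.1) ?_ fun p => ?_
  · rw [eq_top_iff, ← iSup_basicOpen_reesGen_eq_top (coordinateIdeal_mul_eq_span (K := K) I J)]
    refine iSup_le ?_
    rintro ⟨_, a, ha, b, hb, rfl⟩
    by_cases hab : b ∈ I → a = b
    · exact le_iSup (fun p : {p : Fin n × Fin n // p.1 ∈ I ∧ p.2 ∈ J ∧ (p.2 ∈ I → p.1 = p.2)} =>
        Proj.basicOpen (reesGrading (coordinateIdeal K I * coordinateIdeal K J))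
          (reesGen (MvPolynomial.X p.1.1 * MvPolynomial.X p.1.2)
            (X_mul_X_mem p.2.1 p.2.2.1))) ⟨(a, b), ha, hb, hab⟩
    · have hbI : b ∈ I := by_contra fun h => hab fun h' => absurd h' h
      have haJ : a ∈ J := by
        rcases h with h | h
        · exact absurd (show b ∈ I ∩ J from ⟨hbI, hb⟩) (h ▸ Set.notMem_empty b)
        · exact h ha
      refine le_trans ?_ (le_iSup
        (fun p : {p : Fin n × Fin n // p.1 ∈ I ∧ p.2 ∈ J ∧ (p.2 ∈ I → p.1 = p.2)} =>
        Proj.basicOpen (reesGrading (coordinateIdeal K I * coordinateIdeal K J))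
          (reesGen (MvPolynomial.X p.1.1 * MvPolynomial.X p.1.2)
            (X_mul_X_mem p.2.1 p.2.2.1))) ⟨(a, a), ha, haJ, fun _ => rfl⟩)
      -- In degree two, `x_a^2` divides `(x_a x_b)^2` with cofactor `x_b^2`, so the chart at `x_a
      -- x_b` lies in the one at `x_a^2`.
      rw [← Proj.basicOpen_pow _ (reesGen _ _) 2 two_pos]
      refine Proj.basicOpen_mono _ _ _ ⟨reesGen _ (X_mul_X_mem hbI hb), Subtype.ext ?_⟩
      simp only [reesGen, reesMonomial, SubmonoidClass.coe_pow, MulMemClass.coe_mul,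
        Polynomial.monomial_pow, Polynomial.monomial_mul_monomial]
      congr 1
      ring
  · refine smooth_chartMap_X_mul_X p.2.1 p.2.2.1 p.2.2.2 fun b hbI hbJ => ?_
    rcases h with h | h
    · exact absurd (show b ∈ I ∩ J from ⟨hbI, hbJ⟩) (h ▸ Set.notMem_empty b)
    · exact h p.2.1

end Coordinate

/-! ### An obstruction to smoothness -/

section Obstruction

variable {K : Type u} [Field K]

open Polynomial in
theorem exists_eq_of_aeval_eps (p : K[X]) : ∃ (a b : K) (q : K[X]), p = C a + C b * X + X ^ 2 * q ∧
    aeval (DualNumber.eps : DualNumber K) p =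
      algebraMap K (DualNumber K) a + algebraMap K (DualNumber K) b * DualNumber.eps := by
  refine ⟨p.coeff 0, p.divX.coeff 0, p.divX.divX, ?_, ?_⟩
  · conv_lhs => rw [← p.divX_mul_X_add, ← p.divX.divX_mul_X_add]
    ring
  · conv_lhs => rw [← p.divX_mul_X_add, ← p.divX.divX_mul_X_add]
    simp [add_mul, mul_assoc, DualNumber.eps_mul_eps, add_comm]

theorem algebraMap_add_mul_eps_inj {a b a' b' : K}
    (h : algebraMap K (DualNumber K) a + algebraMap K (DualNumber K) b * DualNumber.eps =
      algebraMap K (DualNumber K) a' + algebraMap K (DualNumber K) b' * DualNumber.eps) :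
    a = a' ∧ b = b' := by
  have h1 := congrArg TrivSqZeroExt.fst h
  have h2 := congrArg TrivSqZeroExt.snd h
  simpa [TrivSqZeroExt.algebraMap_eq_inl] using And.intro h1 h2

open Polynomial in
/-- A formally smooth algebra has no relation `x u = y v` for which there is a tangent vector with
values `1, 1, 0, 0` at `x, u, y, v`. -/
theorem mul_ne_mul_of_formallySmooth {A : Type*} [CommRing A] [Algebra K A]
    [Algebra.FormallySmooth K A] (f : A →ₐ[K] DualNumber K) {x u y v : A}
    (hx : f x = DualNumber.eps) (hu : f u = DualNumber.eps) (hy : f y = 0) (hv : f v = 0) :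
    x * u ≠ y * v := by
  intro h
  -- The truncation retains the coefficient of `X ^ 2`, where lifts of `x * u` and `y * v` differ.
  -- The kernel of the map to the dual numbers is generated by `X ^ 2` and squares to zero, so `f`
  -- lifts.
  let N : Ideal K[X] := Ideal.span {X ^ 3}
  let g : (K[X] ⧸ N) →ₐ[K] DualNumber K :=
    Ideal.Quotient.liftₐ N (aeval DualNumber.eps) fun p hp => by
      obtain ⟨q, rfl⟩ := Ideal.mem_span_singleton.mp hp
      simp [pow_succ]
  have hgmk : ∀ p : K[X], g (Ideal.Quotient.mk N p) = aeval DualNumber.eps p := fun p => rfl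
  have hg : Function.Surjective g := fun z => by
    refine ⟨Ideal.Quotient.mk N (C z.fst + C z.snd * X), ?_⟩
    rw [hgmk]
    ext <;> simp [TrivSqZeroExt.algebraMap_eq_inl]
  have hker : IsNilpotent (RingHom.ker (g : (K[X] ⧸ N) →+* DualNumber K)) := by
    have hle : RingHom.ker (g : (K[X] ⧸ N) →+* DualNumber K) ≤
        Ideal.span {Ideal.Quotient.mk N (X ^ 2)} := fun z hz => by
      obtain ⟨p, rfl⟩ := Ideal.Quotient.mk_surjective z
      obtain ⟨a, b, q, hp, hp'⟩ := exists_eq_of_aeval_eps p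
      have hz' : aeval (DualNumber.eps : DualNumber K) p = 0 := hz
      obtain ⟨rfl, rfl⟩ := algebraMap_add_mul_eps_inj (a' := 0) (b' := 0)
        ((hp'.symm.trans hz').trans (by simp))
      rw [Ideal.mem_span_singleton, hp]
      exact ⟨Ideal.Quotient.mk N q, by simp⟩
    refine ⟨2, le_bot_iff.mp ((Ideal.pow_right_mono hle 2).trans ?_)⟩
    rw [Ideal.span_singleton_pow, ← map_pow, Ideal.span_singleton_le_iff_mem, Ideal.mem_bot,
      Ideal.Quotient.eq_zero_iff_mem, Ideal.mem_span_singleton]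
    exact ⟨X, by ring⟩
  let F := Algebra.FormallySmooth.liftOfSurjective f g hg hker
  have hF : ∀ a : A, ∃ p : K[X], Ideal.Quotient.mk N p = F a ∧
      aeval (DualNumber.eps : DualNumber K) p = f a := fun a => by
    obtain ⟨p, hp⟩ := Ideal.Quotient.mk_surjective (F a)
    refine ⟨p, hp, ?_⟩
    rw [← hgmk, hp]
    exact Algebra.FormallySmooth.liftOfSurjective_apply f g hg hker a
  have h1 : ∀ a : A, f a = DualNumber.eps → ∃ q : K[X], F a = Ideal.Quotient.mk N (X + X ^ 2 * q) :=
    fun a ha => by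
      obtain ⟨p, hp, hpf⟩ := hF a
      obtain ⟨c, d, q, hpq, hp'⟩ := exists_eq_of_aeval_eps p
      obtain ⟨rfl, rfl⟩ := algebraMap_add_mul_eps_inj (a' := 0) (b' := 1)
        ((hp'.symm.trans (hpf.trans ha)).trans (by simp))
      exact ⟨q, by rw [← hp, hpq]; simp⟩
  have h0 : ∀ a : A, f a = 0 → ∃ q : K[X], F a = Ideal.Quotient.mk N (X ^ 2 * q) :=
    fun a ha => by
      obtain ⟨p, hp, hpf⟩ := hF a
      obtain ⟨c, d, q, hpq, hp'⟩ := exists_eq_of_aeval_eps p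
      obtain ⟨rfl, rfl⟩ := algebraMap_add_mul_eps_inj (a' := 0) (b' := 0)
        ((hp'.symm.trans (hpf.trans ha)).trans (by simp))
      exact ⟨q, by rw [← hp, hpq]; simp⟩
  obtain ⟨qx, hqx⟩ := h1 x hx
  obtain ⟨qu, hqu⟩ := h1 u hu
  obtain ⟨qy, hqy⟩ := h0 y hy
  obtain ⟨qv, hqv⟩ := h0 v hv
  have hFm := congrArg F h
  rw [map_mul, map_mul, hqx, hqu, hqy, hqv, ← map_mul, ← map_mul, Ideal.Quotient.eq,
    Ideal.mem_span_singleton, X_pow_dvd_iff] at hFm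
  have h2 := hFm 2 (by norm_num)
  -- The coefficient of `X ^ 2` is `1` whatever the lifts are, contradicting its vanishing modulo `X
  -- ^ 3`.
  have h3 : (X + X ^ 2 * qx) * (X + X ^ 2 * qu) - X ^ 2 * qy * (X ^ 2 * qv) =
    X ^ 2 * (1 + X * (qx + qu + X * qx * qu - X * qy * qv)) := by ring
  rw [h3, coeff_X_pow_mul'] at h2
  simp at h2

/-- The weight-one part of a monoid graded by a positive weight consists of tangent vectors. -/
theorem exists_algHom_dualNumber {n : ℕ} (C : AddSubmonoid (Fin n → ℤ)) (wt : (Fin n → ℤ) →+ ℤ)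
    (hwt : ∀ c ∈ C, c = 0 ∨ 1 ≤ wt c) (T : Set (Fin n → ℤ)) (hT : ∀ c ∈ T, wt c = 1) :
    ∃ δ : AddMonoidAlgebra K C →ₐ[K] DualNumber K,
      (∀ c : C, c.1 ∈ T → δ (AddMonoidAlgebra.single c 1) = DualNumber.eps) ∧
      ∀ c : C, wt c = 1 → c.1 ∉ T → δ (AddMonoidAlgebra.single c 1) = 0 := by
  classical
  have h0 : (0 : Fin n → ℤ) ∉ T := fun h => by simpa using hT 0 h
  -- Multiplicativity holds because a sum of two nonzero vectors has weight at least `2`: it is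
  -- neither zero nor in `T`, and on the other side `ε ^ 2 = 0`.
  let m : Multiplicative C →* DualNumber K :=
    { toFun := fun c => if c.toAdd.1 = 0 then 1 else if c.toAdd.1 ∈ T then DualNumber.eps else 0
      map_one' := by simp
      map_mul' := fun a b => by
        by_cases ha : a.toAdd.1 = 0
        · simp [ha]
        by_cases hb : b.toAdd.1 = 0
        · simp [hb]
        have h1 := (hwt _ a.toAdd.2).resolve_left ha
        have h2 := (hwt _ b.toAdd.2).resolve_left hb
        have hab : wt (a.toAdd.1 + b.toAdd.1) = wt a.toAdd.1 + wt b.toAdd.1 := map_add _ _ _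
        have h3 : a.toAdd.1 + b.toAdd.1 ≠ 0 := fun h => by
          rw [h, map_zero] at hab; omega
        have h4 : a.toAdd.1 + b.toAdd.1 ∉ T := fun h => by
          rw [hT _ h] at hab; omega
        simp only [toAdd_mul, AddSubmonoid.coe_add, ha, hb, h3, h4, if_false]
        split_ifs <;> simp }
  refine ⟨AddMonoidAlgebra.lift K (DualNumber K) C m, fun c hc => ?_, fun c hc hcT => ?_⟩
  · have : c.1 ≠ 0 := fun h => h0 (h ▸ hc)
    rw [AddMonoidAlgebra.lift_single, one_smul]
    change (if c.1 = 0 then (1 : DualNumber K) else if c.1 ∈ T then DualNumber.eps else 0) = _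
    rw [if_neg this, if_pos hc]
  · have : c.1 ≠ 0 := fun h => by rw [h, map_zero] at hc; omega
    rw [AddMonoidAlgebra.lift_single, one_smul]
    change (if c.1 = 0 then (1 : DualNumber K) else if c.1 ∈ T then DualNumber.eps else 0) = _
    rw [if_neg this, if_neg hcT]

/-- A chart of the blowup is not smooth if its cone carries a positive weight for which two
different unordered pairs of vectors of weight one have the same sum. -/
theorem not_smooth_chartMap {n : ℕ} {𝔞 : Ideal (MvPolynomial (Fin n) K)} {w : Fin n → ℤ}
    {r : MvPolynomial (Fin n) K} (hr : r ∈ 𝔞) (hw : toLaurent K n r = laurentMonomial K w)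
    (C : AddSubmonoid (Fin n → ℤ)) (wt : (Fin n → ℤ) →+ ℤ) (hwt : ∀ c ∈ C, c = 0 ∨ 1 ≤ wt c)
    (hX : ∀ l, Pi.single l 1 ∈ C) {G : Set (MvPolynomial (Fin n) K)} (hG : 𝔞 = Ideal.span G)
    (hGC : ∀ s ∈ G, ∃ c ∈ C, toLaurent K n s * laurentMonomial K (-w) = laurentMonomial K c)
    {x u y v : Fin n → ℤ} (hmem : ∀ c ∈ ({x, u, y, v} : Set (Fin n → ℤ)), c ∈ C ∧ wt c = 1 ∧
      laurentMonomial K c ∈ Set.range (chartToLaurent hr hw))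
    (h : x + u = y + v) (hxy : x ≠ y) (hxv : x ≠ v) :
    ¬ ((chartMap r hr).comp (algebraMap K (MvPolynomial (Fin n) K))).Smooth := by
  intro hsm
  let : Algebra K (Chart r hr) :=
    ((chartMap r hr).comp (algebraMap K (MvPolynomial (Fin n) K))).toAlgebra
  have hfs : Algebra.FormallySmooth K (Chart r hr) := hsm.formallySmooth
  let φ : Chart r hr →ₐ[K] Laurent K n :=
    { chartToLaurent hr hw with
      commutes' := fun a => by
        change chartToLaurent hr hw (chartMap r hr _) = _
        rw [chartToLaurent_chartMap, AlgHom.commutes] }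
  let j : AddMonoidAlgebra K C →ₐ[K] Laurent K n := AddMonoidAlgebra.mapDomainAlgHom K K C.subtype
  have hj : Function.Injective j := AddMonoidAlgebra.mapDomain_injective Subtype.val_injective
  have hjs : ∀ c : C, j (AddMonoidAlgebra.single c 1) = laurentMonomial K c.1 := fun c => by
    simp [j, laurentMonomial]
  have hφj : ∀ z, φ z ∈ j.range := fun z => by
    refine range_chartToLaurent_le hr hw j.range (fun l => ⟨_, hjs ⟨_, hX l⟩⟩) hG (fun s hs => ?_)
      ⟨z, rfl⟩
    obtain ⟨c, hc, hsc⟩ := hGC s hs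
    rw [hsc]
    exact ⟨_, hjs ⟨c, hc⟩⟩
  obtain ⟨δ, hδ1, hδ0⟩ := exists_algHom_dualNumber (K := K) C wt hwt {x, u} (fun c hc => by
    rcases hc with rfl | rfl
    · exact (hmem c (by simp)).2.1
    · exact (hmem c (by simp)).2.1)
  -- Only the inclusion of the chart into the monoid algebra of `C` is needed to pull `δ` back.
  let f : Chart r hr →ₐ[K] DualNumber K :=
    (δ.comp (AlgEquiv.ofInjective j hj).symm.toAlgHom).comp (φ.codRestrict j.range hφj)
  have hf : ∀ (z : Chart r hr) (c : Fin n → ℤ) (hc : c ∈ C), φ z = laurentMonomial K c →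
      f z = δ (AddMonoidAlgebra.single ⟨c, hc⟩ 1) := fun z c hc hz => by
    change δ ((AlgEquiv.ofInjective j hj).symm ⟨φ z, hφj z⟩) = _
    congr 1
    rw [AlgEquiv.symm_apply_eq]
    refine Subtype.ext ?_
    rw [AlgEquiv.ofInjective_apply, hjs]
    exact hz
  obtain ⟨hxC, hx1, zx, hzx⟩ := hmem x (by simp)
  obtain ⟨huC, hu1, zu, hzu⟩ := hmem u (by simp)
  obtain ⟨hyC, hy1, zy, hzy⟩ := hmem y (by simp)
  obtain ⟨hvC, hv1, zv, hzv⟩ := hmem v (by simp)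
  -- By cancellation in `x + u = y + v`, neither `y` nor `v` lies in `{x, u}`, so the tangent vector
  -- vanishes on both.
  have hyu : y ≠ u := fun e => hxv (by rw [e, add_comm] at h; exact add_left_cancel h)
  have hvu : v ≠ u := fun e => hxy (by rw [e] at h; exact add_right_cancel h)
  refine mul_ne_mul_of_formallySmooth f (x := zx) (u := zu) (y := zy) (v := zv)
    ((hf zx x hxC hzx).trans (hδ1 _ (by simp))) ((hf zu u huC hzu).trans (hδ1 _ (by simp)))
    ((hf zy y hyC hzy).trans (hδ0 _ hy1 ?_)) ((hf zv v hvC hzv).trans (hδ0 _ hv1 ?_)) ?_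
  · simp [hxy.symm, hyu]
  · simp [hxv.symm, hvu]
  · apply chartToLaurent_injective hr hw
    rw [map_mul, map_mul, hzx, hzu, hzy, hzv, ← laurentMonomial_add, ← laurentMonomial_add, h]

end Obstruction

/-! ### The tangent cone and the Newton polyhedron at `e_i + e_j` -/

section Cone

variable {K : Type u} [Field K] {n : ℕ} {I J : Set (Fin n)}

theorem mem_exponents_mul_iff {a : Fin n →₀ ℕ} :
    a ∈ exponents (coordinateIdeal K I * coordinateIdeal K J) ↔
      ∃ p ∈ I, ∃ q ∈ J, Finsupp.single p 1 + Finsupp.single q 1 ≤ a := by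
  classical
  have h : Set.image2 (fun a b => (MvPolynomial.X a * MvPolynomial.X b : MvPolynomial (Fin n) K))
      I J = (fun s => MvPolynomial.monomial s (1 : K)) ''
        Set.image2 (fun a b => Finsupp.single a 1 + Finsupp.single b 1) I J := by
    rw [Set.image_image2]
    simp [MvPolynomial.X, MvPolynomial.monomial_mul]
  rw [exponents, Set.mem_ofPred_eq, coordinateIdeal_mul_eq_span, h,
    MvPolynomial.mem_ideal_span_monomial_image]
  simp [MvPolynomial.support_monomial, Set.mem_image2]

theorem mem_cloud_mul_iff {a : Fin n →₀ ℕ} :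
    a ∈ cloud (coordinateIdeal K I * coordinateIdeal K J) ↔
      ∃ p ∈ I, ∃ q ∈ J, a = Finsupp.single p 1 + Finsupp.single q 1 := by
  constructor
  · intro h
    obtain ⟨p, hp, q, hq, hpq⟩ := mem_exponents_mul_iff.mp h.prop
    exact ⟨p, hp, q, hq, le_antisymm
      (h.le_of_le (mem_exponents_mul_iff.mpr ⟨p, hp, q, hq, le_rfl⟩) hpq) hpq⟩
  · rintro ⟨p, hp, q, hq, rfl⟩
    refine ⟨mem_exponents_mul_iff.mpr ⟨p, hp, q, hq, le_rfl⟩, fun b hb hba => ?_⟩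
    obtain ⟨p', hp', q', hq', hb'⟩ := mem_exponents_mul_iff.mp hb
    obtain ⟨c, rfl⟩ := exists_add_of_le hb'
    obtain ⟨d, hd⟩ := exists_add_of_le hba
    -- All generators have degree two, so none properly divides another.
    have := congrArg Finsupp.degree hd
    simp only [map_add, Finsupp.degree_single] at this
    have hd0 : d = 0 := (Finsupp.degree_eq_zero_iff d).mp (by omega)
    rw [hd, hd0, add_zero]

open Classical in
/-- The weight of the `l`-th coordinate: it is `2` for `l ∈ I ∪ J` different from `i` and `j`, and
`1` otherwise. -/
noncomputable def coordWeight (I J : Set (Fin n)) (i j l : Fin n) : ℤ :=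
  if l ∈ I ∪ J ∧ l ≠ i ∧ l ≠ j then 2 else 1

/-- The additive map to `ℤ` with values `coordWeight I J i j` on the standard basis. -/
noncomputable def weight (I J : Set (Fin n)) (i j : Fin n) : (Fin n → ℤ) →+ ℤ :=
  ∑ l, (AddMonoidHom.mulRight (coordWeight I J i j l)).comp (Pi.evalAddMonoidHom (fun _ => ℤ) l)

theorem weight_single (i j l : Fin n) :
    weight I J i j (Pi.single l 1) = coordWeight I J i j l := by
  simp only [weight, AddMonoidHom.finsetSum_apply, AddMonoidHom.comp_apply,
    Pi.evalAddMonoidHom_apply, AddMonoidHom.coe_mulRight]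
  rw [Finset.sum_eq_single l]
  · simp
  · intro b _ hb; simp [hb]
  · simp

theorem one_le_coordWeight (i j l : Fin n) : 1 ≤ coordWeight I J i j l := by
  unfold coordWeight; split_ifs <;> norm_num

theorem coordWeight_left (i j : Fin n) : coordWeight I J i j i = 1 := by simp [coordWeight]

theorem coordWeight_right (i j : Fin n) : coordWeight I J i j j = 1 := by simp [coordWeight]

theorem coordWeight_eq_two {i j l : Fin n} (hl : l ∈ I ∪ J) (hi : l ≠ i) (hj : l ≠ j) :
    coordWeight I J i j l = 2 := if_pos ⟨hl, hi, hj⟩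

variable {i j : Fin n} (hi : i ∈ I \ J) (hj : j ∈ J \ I)

include hi hj in
-- Since `j ∉ I` and `i ∉ J`, a factor from `I` has weight one only if it is `x_i`, and a factor
-- from `J` only if it is `x_j`. Thus `x_i x_j` is the only generator of weight two.
theorem coordWeight_add_eq_two_or {a b : Fin n} (ha : a ∈ I) (hb : b ∈ J) :
    (a = i ∧ b = j) ∨ 3 ≤ coordWeight I J i j a + coordWeight I J i j b := by
  by_cases hai : a = i
  · by_cases hbj : b = j
    · exact Or.inl ⟨hai, hbj⟩
    · have h2 := coordWeight_eq_two (I := I) (Or.inr hb) (fun e => hi.2 (e ▸ hb) : b ≠ i) hbj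
      have h1 := one_le_coordWeight (I := I) (J := J) i j a
      right; omega
  · have h2 := coordWeight_eq_two (J := J) (Or.inl ha) hai (fun e => hj.2 (e ▸ ha) : a ≠ j)
    have h1 := one_le_coordWeight (I := I) (J := J) i j b
    right; omega

theorem single_mem_idealTangentCone (𝔞 : Ideal (MvPolynomial (Fin n) K)) (a : Fin n →₀ ℕ)
    (l : Fin n) : Pi.single l 1 ∈ idealTangentCone 𝔞 a :=
  AddSubmonoid.mem_sup_right (AddSubmonoid.subset_closure ⟨l, rfl⟩)

theorem coe_single_add_single (p q : Fin n) :
    (fun l => (((Finsupp.single p 1 + Finsupp.single q 1 : Fin n →₀ ℕ) l : ℕ) : ℤ)) =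
      Pi.single p 1 + Pi.single q 1 := by
  ext l
  simp [Finsupp.single_apply, Pi.single_apply, eq_comm]

theorem sub_mem_idealTangentCone {a b : Fin n} (ha : a ∈ I) (hb : b ∈ J) {v : Fin n → ℤ}
    (hv : v = Pi.single a 1 + Pi.single b 1 - (Pi.single i 1 + Pi.single j 1)) :
    v ∈ idealTangentCone (coordinateIdeal K I * coordinateIdeal K J)
      (Finsupp.single i 1 + Finsupp.single j 1) := by
  by_cases h : (Finsupp.single a 1 + Finsupp.single b 1 : Fin n →₀ ℕ) =
      Finsupp.single i 1 + Finsupp.single j 1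
  · rw [← coe_single_add_single, ← coe_single_add_single, h, sub_self] at hv
    rw [hv]
    exact zero_mem _
  · refine AddSubmonoid.mem_sup_left (AddSubmonoid.subset_closure
      ⟨_, mem_cloud_mul_iff.mpr ⟨a, ha, b, hb, rfl⟩, h, ?_⟩)
    rw [hv, ← coe_single_add_single, ← coe_single_add_single]
    rfl

include hi hj in
theorem eq_zero_or_one_le_weight {v : Fin n → ℤ}
    (hv : v ∈ idealTangentCone (coordinateIdeal K I * coordinateIdeal K J)
      (Finsupp.single i 1 + Finsupp.single j 1)) : v = 0 ∨ 1 ≤ weight I J i j v := by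
  rw [idealTangentCone, ← AddSubmonoid.closure_union] at hv
  induction hv using AddSubmonoid.closure_induction with
  | mem v hv =>
    right
    rcases hv with ⟨a', ha', hne, rfl⟩ | ⟨l, rfl⟩
    · obtain ⟨a, ha, b, hb, rfl⟩ := mem_cloud_mul_iff.mp ha'
      have h : weight I J i j ((Pi.single a 1 + Pi.single b 1) - (Pi.single i 1 + Pi.single j 1)) =
          coordWeight I J i j a + coordWeight I J i j b - 2 := by
        rw [map_sub, map_add, map_add]
        simp only [weight_single, coordWeight_left, coordWeight_right]
        norm_num
      rw [← coe_single_add_single, ← coe_single_add_single] at h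
      refine le_of_le_of_eq ?_ h.symm
      rcases coordWeight_add_eq_two_or hi hj ha hb with ⟨rfl, rfl⟩ | h3
      · exact absurd rfl hne
      · omega
    · change 1 ≤ weight I J i j (Pi.single l 1)
      rw [weight_single]
      exact one_le_coordWeight i j l
  | zero => exact Or.inl rfl
  | add a b _ _ ha hb =>
    rcases ha with rfl | ha
    · rwa [zero_add]
    · rcases hb with rfl | hb
      · rw [add_zero]; exact Or.inr ha
      · rw [map_add]; exact Or.inr (by omega)

include hi hj in
theorem isPointed_idealTangentCone :
    IsPointed (idealTangentCone (coordinateIdeal K I * coordinateIdeal K J)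
      (Finsupp.single i 1 + Finsupp.single j 1)) := fun v hv hv' => by
  rcases eq_zero_or_one_le_weight hi hj hv with h | h
  · exact h
  · rcases eq_zero_or_one_le_weight hi hj hv' with h' | h'
    · exact neg_eq_zero.mp h'
    · rw [map_neg] at h'; omega

/-- Elements of weight one lie in every generating set. -/
theorem mem_of_mem_closure_of_weight_eq_one {C : AddSubmonoid (Fin n → ℤ)}
    {wt : (Fin n → ℤ) →+ ℤ} (hwt : ∀ c ∈ C, c = 0 ∨ 1 ≤ wt c) {S : Set (Fin n → ℤ)}
    (hS : AddSubmonoid.closure S = C) {c : Fin n → ℤ} (hc : c ∈ C) (hc1 : wt c = 1) : c ∈ S := by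
  subst hS
  induction hc using AddSubmonoid.closure_induction with
  | mem c hc => exact hc
  | zero => simp at hc1
  -- Two nonzero summands would have total weight at least `2`, so one of them is zero.
  | add a b ha hb iha ihb =>
    rw [map_add] at hc1
    rcases hwt a ha with rfl | h1
    · rw [zero_add]; exact ihb (by simpa using hc1)
    · rcases hwt b hb with rfl | h2
      · rw [add_zero]; exact iha (by simpa using hc1)
      · omega

include hj in
theorem weight_sub_left_eq_one {a : Fin n} (ha : a ∈ I) (hai : a ≠ i) :
    weight I J i j (Pi.single a 1 - Pi.single i 1) = 1 := by
  rw [map_sub, weight_single, weight_single, coordWeight_left,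
    coordWeight_eq_two (Or.inl ha) hai (fun e => hj.2 (e ▸ ha) : a ≠ j)]
  norm_num

include hi in
theorem weight_sub_right_eq_one {b : Fin n} (hb : b ∈ J) (hbj : b ≠ j) :
    weight I J i j (Pi.single b 1 - Pi.single j 1) = 1 := by
  rw [map_sub, weight_single, weight_single, coordWeight_right,
    coordWeight_eq_two (Or.inr hb) (fun e => hi.2 (e ▸ hb) : b ≠ i) hbj]
  norm_num

include hi hj in
theorem not_isSimplicial_idealTangentCone (hIJ : (I ∩ J).Nonempty) :
    ¬ IsSimplicial (idealTangentCone (coordinateIdeal K I * coordinateIdeal K J)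
      (Finsupp.single i 1 + Finsupp.single j 1)) := by
  classical
  rintro ⟨-, S, ⟨hS, -⟩, hcard⟩
  obtain ⟨k, hkI, hkJ⟩ := hIJ
  have hki : k ≠ i := fun e => hi.2 (e ▸ hkJ)
  have hkj : k ≠ j := fun e => hj.2 (e ▸ hkI)
  have hij : i ≠ j := fun e => hi.2 (e ▸ hj.1)
  have hmem : ∀ {c}, c ∈ idealTangentCone (coordinateIdeal K I * coordinateIdeal K J)
      (Finsupp.single i 1 + Finsupp.single j 1) → weight I J i j c = 1 → c ∈ S :=
    fun hc hc1 => mem_of_mem_closure_of_weight_eq_one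
      (fun c hc => eq_zero_or_one_le_weight hi hj hc) hS hc hc1
  -- These are `n + 1` vectors of weight one: one for each coordinate, and the extra `e_k - e_j`.
  -- The index `k` itself gives `e_k - e_i`, as `k ∈ I`.
  let F : Option (Fin n) → Fin n → ℤ := fun o => o.elim (Pi.single k 1 - Pi.single j 1) fun l =>
    if l ∈ I ∪ J ∧ l ≠ i ∧ l ≠ j then
      (if l ∈ I then Pi.single l 1 - Pi.single i 1 else Pi.single l 1 - Pi.single j 1)
    else Pi.single l 1
  have hFS : ∀ o, F o ∈ S := by
    rintro (_ | l)
    · change (Pi.single k 1 - Pi.single j 1 : Fin n → ℤ) ∈ S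
      exact hmem (sub_mem_idealTangentCone hi.1 hkJ (by abel))
        (weight_sub_right_eq_one hi hkJ hkj)
    · simp only [F, Option.elim]
      split_ifs with h1 h2
      · exact hmem (sub_mem_idealTangentCone h2 hj.1 (by abel))
          (weight_sub_left_eq_one hj h2 h1.2.1)
      · have h3 := h1.1.resolve_left h2
        exact hmem (sub_mem_idealTangentCone hi.1 h3 (by abel))
          (weight_sub_right_eq_one hi h3 h1.2.2)
      · exact hmem (single_mem_idealTangentCone _ _ l)
          (by rw [weight_single, coordWeight, if_neg h1])
  -- The index is recovered as the position of the only entry `1`. The extra vector could then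
  -- coincide only with `F (some k)`, but their `j`-th entries are `-1` and `0`.
  have hFl : ∀ l m, F (some l) m = 1 ↔ m = l := by
    intro l m
    simp only [F, Option.elim]
    split_ifs <;> simp only [Pi.sub_apply, Pi.single_apply] <;> split_ifs <;> simp_all
  have hFinj : Function.Injective F := by
    rintro (_ | l) (_ | l') h
    · rfl
    · have h1 : F (some l') k = 1 := by rw [← h]; simp [F, hkj]
      have hkl := (hFl l' k).mp h1
      subst hkl
      have h2 := congrFun h j
      simp [F, hkI, hki, hkj, Ne.symm hkj, hij.symm] at h2
    · have h1 : F (some l) k = 1 := by rw [h]; simp [F, hkj]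
      have hkl := (hFl l k).mp h1
      subst hkl
      have h2 := congrFun h j
      simp [F, hkI, hki, hkj, Ne.symm hkj, hij.symm] at h2
    · have h1 : F (some l') l = 1 := by rw [← h]; exact (hFl l l).mpr rfl
      rw [(hFl l' l).mp h1]
  have hle := Finset.card_le_card_of_injOn (s := Finset.univ) (t := S) F (fun o _ => hFS o)
    hFinj.injOn
  rw [Finset.card_univ, Fintype.card_option, Fintype.card_fin, hcard] at hle
  omega

/-- An open half-space together with the single boundary point `x` is convex, so `x` remains the
only minimizer of `f` on the convex hull, and a unique minimizer is extreme. -/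
theorem mem_extremePoints_of_forall_lt {E : Type*} [AddCommGroup E] [Module ℝ E] {A : Set E}
    {x : E} (hx : x ∈ A) (f : E →ₗ[ℝ] ℝ) (hf : ∀ y ∈ A, y ≠ x → f x < f y) :
    x ∈ Set.extremePoints ℝ (convexHull ℝ A) := by
  have hconv : Convex ℝ ({y | f x < f y} ∪ {x}) := by
    rw [convex_iff_forall_pos]
    have hsum : ∀ {a b : ℝ}, a + b = 1 → ∀ y z, f (a • y + b • z) - f x =
        a * (f y - f x) + b * (f z - f x) := fun {a b} hab y z => by
      rw [map_add, map_smul, map_smul, smul_eq_mul, smul_eq_mul]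
      linear_combination (f x) * hab
    rintro y (hy | rfl) z (hz | rfl) a b ha hb hab
    · left
      have h1 := hsum hab y z
      have h2 := mul_pos ha (sub_pos.mpr hy)
      have h3 := mul_pos hb (sub_pos.mpr hz)
      rw [Set.mem_ofPred_eq]; linarith
    · left
      have h1 := hsum hab y z
      have h2 := mul_pos ha (sub_pos.mpr hy)
      rw [sub_self, mul_zero, add_zero] at h1
      rw [Set.mem_ofPred_eq]; linarith
    · left
      have h1 := hsum hab y z
      have h3 := mul_pos hb (sub_pos.mpr hz)
      rw [sub_self, mul_zero, zero_add] at h1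
      rw [Set.mem_ofPred_eq]; linarith
    · right
      rw [← add_smul, hab, one_smul]; rfl
  have hsub : convexHull ℝ A ⊆ {y | f x < f y} ∪ {x} := by
    refine convexHull_min (fun y hy => ?_) hconv
    by_cases h : y = x
    · exact Or.inr h
    · exact Or.inl (hf y hy h)
  refine ⟨subset_convexHull ℝ A hx, fun y hy z hz hyz => ?_⟩
  obtain ⟨a, b, ha, hb, hab, hxe⟩ := hyz
  have h1 : f x = a * f y + b * f z := by
    conv_lhs => rw [← hxe]
    simp
  rcases hsub hy with hy' | hy'
  · exfalso
    have hz' : f x ≤ f z := by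
      rcases hsub hz with h | h
      · exact le_of_lt h
      · rw [h]
    have h2 := mul_lt_mul_of_pos_left hy' ha
    have h3 := mul_le_mul_of_nonneg_left hz' hb.le
    have h4 : f x = a * f x + b * f x := by rw [← add_mul, hab, one_mul]
    linarith
  · exact hy'

include hi hj in
theorem isNewtonVertex_single_add_single :
    IsNewtonVertex (coordinateIdeal K I * coordinateIdeal K J)
      (Finsupp.single i 1 + Finsupp.single j 1) := by
  let f : (Fin n → ℝ) →ₗ[ℝ] ℝ := ∑ l, (coordWeight I J i j l : ℝ) • LinearMap.proj l
  have hf : ∀ a : Fin n →₀ ℕ, f (fun l => (a l : ℝ)) =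
      ((∑ l, coordWeight I J i j l * (a l : ℤ) : ℤ) : ℝ) := fun a => by
    simp [f]
  have hsum : ∀ p q : Fin n, ∑ l, coordWeight I J i j l *
      (((Finsupp.single p 1 + Finsupp.single q 1 : Fin n →₀ ℕ) l : ℕ) : ℤ) =
      coordWeight I J i j p + coordWeight I J i j q := fun p q => by
    simp [Finsupp.single_apply, mul_add, Finset.sum_add_distrib]
  refine mem_extremePoints_of_forall_lt
    ⟨_, mem_exponents_mul_iff.mpr ⟨i, hi.1, j, hj.1, le_rfl⟩, rfl⟩ f ?_
  rintro _ ⟨a, ha, rfl⟩ hne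
  change f (fun l => _) < f (fun l => _)
  rw [hf, hf, hsum, Int.cast_lt, coordWeight_left, coordWeight_right]
  obtain ⟨p, hp, q, hq, hpq⟩ := mem_exponents_mul_iff.mp ha
  obtain ⟨c, rfl⟩ := exists_add_of_le hpq
  have h1 : ∑ l, coordWeight I J i j l * (((Finsupp.single p 1 + Finsupp.single q 1 + c :
      Fin n →₀ ℕ) l : ℕ) : ℤ) = coordWeight I J i j p + coordWeight I J i j q +
      ∑ l, coordWeight I J i j l * (c l : ℤ) := by
    rw [← hsum, ← Finset.sum_add_distrib]
    refine Finset.sum_congr rfl fun l _ => ?_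
    rw [Finsupp.add_apply, Nat.cast_add, mul_add]
  rw [h1]
  have hnn : ∀ l, 0 ≤ coordWeight I J i j l * (c l : ℤ) := fun l =>
    mul_nonneg (zero_le_one.trans (one_le_coordWeight i j l)) (Int.natCast_nonneg _)
  have h2 : 0 ≤ ∑ l, coordWeight I J i j l * (c l : ℤ) := Finset.sum_nonneg fun l _ => hnn l
  rcases coordWeight_add_eq_two_or hi hj hp hq with ⟨rfl, rfl⟩ | h3
  · rw [coordWeight_left, coordWeight_right]
    by_contra hlt
    have h3 : ∑ l, coordWeight I J p q l * (c l : ℤ) = 0 := by omega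
    rw [Finset.sum_eq_zero_iff_of_nonneg fun l _ => hnn l] at h3
    apply hne
    -- All weights are positive, so a cofactor of weight zero is trivial.
    have hc : c = 0 := by
      ext l
      have := h3 l (Finset.mem_univ l)
      have hw := one_le_coordWeight (I := I) (J := J) p q l
      rcases mul_eq_zero.mp this with h | h
      · omega
      · exact_mod_cast h
    rw [hc, add_zero]
  · omega

include hi hj in
theorem not_isTame (hIJ : (I ∩ J).Nonempty) :
    ¬ IsTame (coordinateIdeal K I * coordinateIdeal K J) := by
  intro h
  obtain ⟨k, hkI, hkJ⟩ := hIJ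
  have hki : k ≠ i := fun e => hi.2 (e ▸ hkJ)
  have hkj : k ≠ j := fun e => hj.2 (e ▸ hkI)
  have hij : i ≠ j := fun e => hi.2 (e ▸ hj.1)
  -- The relation is `e_i + (e_k - e_i) = e_j + (e_k - e_j)`, both sides being `e_k`.
  refine not_smooth_chartMap (X_mul_X_mem (K := K) hi.1 hj.1) (toLaurent_X_mul_X i j)
    (idealTangentCone (coordinateIdeal K I * coordinateIdeal K J)
      (Finsupp.single i 1 + Finsupp.single j 1)) (weight I J i j)
    (fun c hc => eq_zero_or_one_le_weight hi hj hc) (single_mem_idealTangentCone _ _)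
    (coordinateIdeal_mul_eq_span I J) ?_ (x := Pi.single i 1) (u := Pi.single k 1 - Pi.single i 1)
    (y := Pi.single j 1) (v := Pi.single k 1 - Pi.single j 1) ?_ (by abel) ?_ ?_
    (smooth_chartMap_of_smooth _ h _ (X_mul_X_mem hi.1 hj.1))
  · rintro _ ⟨a, ha, b, hb, rfl⟩
    refine ⟨_, sub_mem_idealTangentCone ha hb rfl, ?_⟩
    rw [toLaurent_X_mul_X, ← laurentMonomial_add, ← sub_eq_add_neg]
  · have hL := laurentMonomial_single_mem_range (K := K) hi.1 hj.1
    rintro c (rfl | rfl | rfl | rfl)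
    · exact ⟨single_mem_idealTangentCone _ _ i, by rw [weight_single, coordWeight_left], hL i⟩
    · exact ⟨sub_mem_idealTangentCone hkI hj.1 (by abel), weight_sub_left_eq_one hj hkI hki,
        laurentMonomial_sub_mem_range hi.1 hj.1 hkI hj.1 (by abel)⟩
    · exact ⟨single_mem_idealTangentCone _ _ j, by rw [weight_single, coordWeight_right], hL j⟩
    · exact ⟨sub_mem_idealTangentCone hi.1 hkJ (by abel), weight_sub_right_eq_one hi hkJ hkj,
        laurentMonomial_sub_mem_range hi.1 hj.1 hi.1 hkJ (by abel)⟩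
  · intro e
    simpa [hij] using congrFun e i
  · intro e
    simpa [hij, Ne.symm hki] using congrFun e i

end Cone

end TameBlowup

open TameBlowup
theorem mainTheorem6 {K : Type*} [Field K] {n : ℕ} (I J : Set (Fin n)) :
    (IsTame (coordinateIdeal K I * coordinateIdeal K J) ↔ I ∩ J = ∅ ∨ I ⊆ J ∨ J ⊆ I) ∧
    (¬ (I ∩ J = ∅ ∨ I ⊆ J ∨ J ⊆ I) →
      (I \ J).Nonempty ∧ (J \ I).Nonempty ∧
      ∀ i ∈ I \ J, ∀ j ∈ J \ I,
        IsNewtonVertex (coordinateIdeal K I * coordinateIdeal K J)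
          (Finsupp.single i 1 + Finsupp.single j 1) ∧
        IsPointed (idealTangentCone (coordinateIdeal K I * coordinateIdeal K J)
          (Finsupp.single i 1 + Finsupp.single j 1)) ∧
        ¬ IsSimplicial (idealTangentCone (coordinateIdeal K I * coordinateIdeal K J)
          (Finsupp.single i 1 + Finsupp.single j 1))) := by
  have hne : ¬ (I ∩ J = ∅ ∨ I ⊆ J ∨ J ⊆ I) →
      (I ∩ J).Nonempty ∧ (I \ J).Nonempty ∧ (J \ I).Nonempty := fun h => by
    simp only [not_or] at h
    exact ⟨Set.nonempty_iff_ne_empty.mpr h.1, Set.not_subset.mp h.2.1, Set.not_subset.mp h.2.2⟩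
  refine ⟨⟨fun h => ?_, fun h => ?_⟩, fun h => ?_⟩
  · by_contra hc
    obtain ⟨hIJ, ⟨i, hi⟩, ⟨j, hj⟩⟩ := hne hc
    exact not_isTame hi hj hIJ h
  · rcases h with h | h | h
    · exact isTame_of_disjoint_or_subset (Or.inl h)
    · exact isTame_of_disjoint_or_subset (Or.inr h)
    · rw [mul_comm]
      exact isTame_of_disjoint_or_subset (Or.inr h)
  · obtain ⟨hIJ, hI, hJ⟩ := hne h
    exact ⟨hI, hJ, fun i hi j hj => ⟨isNewtonVertex_single_add_single hi hj,
      isPointed_idealTangentCone hi hj, not_isSimplicial_idealTangentCone hi hj hIJ⟩⟩
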